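/- Let $I$ and $O$ be finite disjoint sets of input and output signals. Input words $w\in(2^I)^\omega$ are random, with independent letters that are uniform on $2^I$. Let $\phi$ be an $\mathrm{LTL}[\mathcal F]$ formula over $I\cup O$ (LTL with operators from an arbitrary set $\mathcal F$ of functions $[0,1]^k\to[0,1]$), with satisfaction values $[\![\pi,\phi]\!]\in[0,1]$ and the (finite) set of possible values $V(\phi)=\{v_1<\dots<v_n\}$, and let $\psi$ be an LTL formula over $I$ with $\Pr(w\models\psi)>0$. Let $\mathcal A_\psi$ be a deterministic parity automaton (a run is accepting iff the maximal rank that is seen infinitely often is even) over $2^I$ with language $\{w: w\models\psi\}$, and for every $i\le n$ let $\mathcal A_i$ be a deterministic parity automaton over $2^{I\cup O}$ with language $\{\pi:[\![\pi,\phi]\!]=v_i\}$. A deterministic automaton with transition function $\delta$ over $2^{I\cup O}$ induces a Markov decision process (MDP) on its states with action set $2^O$: if $o\in 2^O$ is chosen in state $q$, then $i\in 2^I$ is drawn uniformly and the next state is $\delta(q,i\cup o)$. Likewise $\mathcal A_\psi$ induces a Markov chain on its states. An end component of an MDP is a nonempty set $C$ of states for which there are nonempty sets $B_s$ of actions ($s\in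 C$) such that actions in $B_s$ lead from $s$ to $C$ with probability $1$ and every two states of $C$ are connected by a path in $C$ that uses these actions only. An ergodic component of a Markov chain is a nonempty strongly connected set of states that is left with probability $0$. Let $\mathcal M=\langle S,s_0,2^O,P,\gamma\rangle$ be the MDP induced by the product $\mathcal A_\psi\times\mathcal A_1\times\dots\times\mathcal A_n$ (where $\mathcal A_\psi$ ignores the output signals), with the following reward $\gamma$. If $s=\langle q,q_1,\dots,q_n\rangle$ belongs to an end component of $\mathcal M$, then $\gamma(s)$ is the maximal $v_i$ such that $q_i$ belongs to an end component of the MDP of $\mathcal A_i$ in which the maximal rank is even ($0$ if there is none); otherwise $\gamma(s)=0$. Let $\mathcal M'$ be the MDP obtained from $\mathcal M$ by moving with probability $1$ to $s_0$, whatever the action, from every state $\langle q,q_1,\dots,q_n\rangle$ such that $q$ belongs to an ergodic component of the Markov chain of $\mathcal A_\psi$ in which the maximal rank is odd. The reward of a run $s_0,s_1,\dots$ is $\liminf_{m\to\infty}\frac1m\sum_{j=0}^m\gamma(s_j)$. For a memoryless strategy $g:S\to 2^O$, let $\mathrm{val}_{\mathcal M'}(g)$ be the expected reward of a run of the Markov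 chain that $g$ induces in $\mathcal M'$, and for $f:S\to2^O$ let $R_{\mathcal M,f}(w)$ be the reward of the run of $\mathcal M$ with $f$ on the input word $w$, that is, the run in which $s_{j+1}$ is the successor of $s_j$ under the letter $w_j\cup f(s_j)$. Then for every $v\in\mathbb R$ and every memoryless strategy $g$ in $\mathcal M'$ with $\mathrm{val}_{\mathcal M'}(g)\ge v$ there is a memoryless strategy $f$ in $\mathcal M$ with $\mathbb E[R_{\mathcal M,f}\mid w\models\psi]\ge v$. Moreover, $f$ can be computed from $g$ in polynomial time: there is one polynomial-time Turing machine that, for all such data, maps the table of $g$ to the table of such an $f$. -/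

import Mathlib

open MeasureTheory ProbabilityTheory Filter

noncomputable section

namespace HQS

/-! ### The logics LTL[F] and LTL -/

/-- The letters of `2^AP`, as truth assignments. -/
abbrev Letter (AP : Type) : Type := AP → Bool

/-- Infinite words (computations) over `Sig`. -/
abbrev Word (Sig : Type) : Type := ℕ → Sig

/-- The suffix of `π` that starts at position `j`. -/
def Word.suffix {Sig : Type} (π : Word Sig) (j : ℕ) : Word Sig := fun n => π (j + n)

/-- A set of quality operators: for every arity `k`, a set of functions `[0,1]^k → [0,1]`. -/
abbrev QualityOps : Type := (k : ℕ) → Set ((Fin k → unitInterval) → unitInterval)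

/-- Formulas of LTL[F] over the atomic propositions `AP`. -/
inductive FLTL (F : QualityOps) (AP : Type) : Type
  | tt : FLTL F AP
  | ff : FLTL F AP
  | atom (p : AP) : FLTL F AP
  | op {k : ℕ} (f : F k) (args : Fin k → FLTL F AP) : FLTL F AP
  | next (a : FLTL F AP) : FLTL F AP
  | untl (a b : FLTL F AP) : FLTL F AP

namespace FLTL

variable {F : QualityOps} {AP : Type}

/-- The satisfaction value of a formula in a computation. An infimum over the empty set is `1`;
the supremum in the until case is a maximum, because a formula has finitely many values. -/
def sem : FLTL F AP → Word (Letter AP) → unitInterval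
  | tt, _ => 1
  | ff, _ => 0
  | atom p, π => if π 0 p = true then 1 else 0
  | op f args, π => f.1 (fun j => (args j).sem π)
  | next a, π => a.sem (π.suffix 1)
  | untl a b, π => ⨆ i : ℕ, b.sem (π.suffix i) ⊓ ⨅ j : Fin i, a.sem (π.suffix j)

/-- The set `V(φ)` of possible satisfaction values of `φ`. -/
def values (φ : FLTL F AP) : Set unitInterval := Set.range φ.sem

/-- A formula has finitely many satisfaction values. -/
theorem finite_values (φ : FLTL F AP) : φ.values.Finite := by
  unfold values
  induction φ with
  | tt => exact (Set.finite_singleton 1).subset (by rintro _ ⟨π, rfl⟩; simp [sem])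
  | ff => exact (Set.finite_singleton 0).subset (by rintro _ ⟨π, rfl⟩; simp [sem])
  | atom p =>
    refine (Set.toFinite {0, 1}).subset ?_
    rintro _ ⟨π, rfl⟩
    simp only [sem]; split <;> simp
  | op f args ih =>
    refine ((Set.Finite.pi' ih).image f.1).subset ?_
    rintro _ ⟨π, rfl⟩
    exact ⟨fun j => (args j).sem π, fun j => ⟨π, rfl⟩, by simp [sem]⟩
  | next a ih =>
    refine ih.subset ?_
    rintro _ ⟨π, rfl⟩
    exact ⟨π.suffix 1, by simp [sem]⟩
  | untl a b iha ihb =>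
    have hfin : (insert 1 (Set.range a.sem ∪ Set.range b.sem)).Finite := (iha.union ihb).insert 1
    refine hfin.subset ?_
    rintro _ ⟨π, rfl⟩
    have hterm : ∀ i : ℕ, b.sem (π.suffix i) ⊓ ⨅ j : Fin i, a.sem (π.suffix j) ∈
        insert 1 (Set.range a.sem ∪ Set.range b.sem) := by
      intro i
      have hinf : (⨅ j : Fin i, a.sem (π.suffix j)) ∈
          insert 1 (Set.range a.sem ∪ Set.range b.sem) := by
        rcases isEmpty_or_nonempty (Fin i) with h | h
        · left; rw [iInf_of_empty]; rfl
        · obtain ⟨j, hj⟩ := exists_eq_ciInf_of_finite (f := fun j : Fin i => a.sem (π.suffix j))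
          right; left; exact ⟨_, hj⟩
      rcases min_choice (b.sem (π.suffix i)) (⨅ j : Fin i, a.sem (π.suffix j)) with h | h
      · rw [h]; right; right; exact ⟨_, rfl⟩
      · rw [h]; exact hinf
    simp only [sem]
    have hs : (Set.range fun i : ℕ => b.sem (π.suffix i) ⊓ ⨅ j : Fin i, a.sem (π.suffix j)).Finite :=
      hfin.subset (by rintro _ ⟨i, rfl⟩; exact hterm i)
    obtain ⟨i, hi⟩ := (Set.range_nonempty _).csSup_mem hs
    rw [iSup, ← hi]; exact hterm i

instance (φ : FLTL F AP) : Finite φ.values := φ.finite_values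

end FLTL

/-- The usual Boolean operators, as operators on `[0,1]`. -/
inductive IsBoolOp : (k : ℕ) → ((Fin k → unitInterval) → unitInterval) → Prop
  | neg : IsBoolOp 1 (fun x => unitInterval.symm (x 0))
  | or : IsBoolOp 2 (fun x => x 0 ⊔ x 1)
  | and : IsBoolOp 2 (fun x => x 0 ⊓ x 1)
  | imp : IsBoolOp 2 (fun x => unitInterval.symm (x 0) ⊔ x 1)

/-- LTL is LTL[F] for the Boolean operators. -/
abbrev LTL (AP : Type) : Type := FLTL (fun k => {f | IsBoolOp k f}) AP

/-- The set `{w : w ⊨ ψ}`. -/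
def LTL.models {AP : Type} (ψ : LTL AP) : Set (Word (Letter AP)) := {w | FLTL.sem ψ w = 1}

/-! ### Deterministic automata -/

/-- A deterministic pre-automaton with a total transition function. -/
structure PreAutomaton (Sig Q : Type) where
  init : Q
  step : Q → Sig → Q

/-- The run of a pre-automaton on an infinite word. -/
def PreAutomaton.run {Sig Q : Type} (B : PreAutomaton Sig Q) (w : Word Sig) : ℕ → Q
  | 0 => B.init
  | n + 1 => B.step (B.run w n) (w n)

/-- A deterministic parity automaton. -/
structure DPW (Sig Q : Type) extends PreAutomaton Sig Q where
  rank : Q → ℕ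
  rank_pos : ∀ q, 1 ≤ rank q

/-- The states that occur infinitely often in `r`. -/
def infOften {Q : Type} (r : ℕ → Q) : Set Q := {q | ∃ᶠ j in atTop, r j = q}

/-- The maximal rank that occurs in `C` is attained at `q ∈ C`. -/
def IsMaxRankIn {Q : Type} (rank : Q → ℕ) (C : Set Q) (q : Q) : Prop :=
  q ∈ C ∧ ∀ p ∈ C, rank p ≤ rank q

/-- The language of a DPW: the maximal rank seen infinitely often is even. -/
def DPW.language {Sig Q : Type} (A : DPW Sig Q) : Set (Word Sig) :=
  {w | ∃ q, IsMaxRankIn A.rank (infOften (A.run w)) q ∧ Even (A.rank q)}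

/-! ### Markov chains and Markov decision processes -/

structure MarkovChain (S : Type) where
  init : S
  P : S → PMF S

/-- The transition kernel of a Markov chain; the state space carries the discrete σ-algebra. -/
def MarkovChain.kernel {S : Type} [MeasurableSpace S] [DiscreteMeasurableSpace S]
    (M : MarkovChain S) : Kernel S S where
  toFun s := (M.P s).toMeasure
  measurable' := Measurable.of_discrete

instance MarkovChain.isMarkovKernel_kernel {S : Type} [MeasurableSpace S]
    [DiscreteMeasurableSpace S] (M : MarkovChain S) : IsMarkovKernel M.kernel :=
  ⟨fun s => inferInstanceAs (IsProbabilityMeasure (M.P s).toMeasure)⟩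

/-- The distribution of the infinite runs of a Markov chain (Ionescu-Tulcea): the run starts in
`M.init`, and the next state is drawn from the transition probabilities of the current one. -/
def MarkovChain.runMeasure {S : Type} [MeasurableSpace S] [DiscreteMeasurableSpace S]
    (M : MarkovChain S) : Measure (ℕ → S) :=
  Kernel.traj (X := fun _ => S)
    (fun n => M.kernel.comap (fun h : (i : Finset.Iic n) → S => h ⟨n, by simp⟩)
      (measurable_pi_apply _)) 0 (fun _ => M.init)

/-- Every state of `C` can reach every state of `C` along `edge`, through states of `C` only. -/
def StronglyConnectedIn {S : Type} (C : Set S) (edge : S → S → Prop) : Prop :=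
  ∀ s ∈ C, ∀ t ∈ C, Relation.ReflTransGen (fun x y => x ∈ C ∧ y ∈ C ∧ edge x y) s t

/-- Ergodic components: strongly connected sets that cannot be left. -/
def MarkovChain.IsErgodicComponent {S : Type} (M : MarkovChain S) (C : Set S) : Prop :=
  C.Nonempty ∧ StronglyConnectedIn C (fun x y => 0 < M.P x y) ∧
    ∀ s ∈ C, ∀ t ∉ C, M.P s t = 0

/-- Markov decision processes without rewards, in which all actions are available in all states. -/
structure PreMDP (S Act : Type) where
  init : S
  P : S → Act → PMF S

/-- Markov decision processes, in which all actions are available in all states. -/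
structure MDP (S Act : Type) extends PreMDP S Act where
  reward : S → ℝ

/-- End components. The condition that `B s` is nonempty on `C` says that one can stay in `C`
forever. -/
def PreMDP.IsEndComponent {S Act : Type} (M : PreMDP S Act) (C : Set S) : Prop :=
  C.Nonempty ∧ ∃ B : S → Set Act,
    (∀ s ∈ C, (B s).Nonempty) ∧
    StronglyConnectedIn C (fun x y => ∃ a ∈ B x, 0 < M.P x a y) ∧
    ∀ s ∈ C, ∀ a ∈ B s, ∑' t : C, M.P s a t = 1

/-- Memoryless strategies of an MDP with states `S` and actions `Act`. -/
abbrev MemorylessStrategy (S Act : Type) : Type := S → Act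

/-- The Markov chain that a memoryless strategy induces. -/
def PreMDP.chain {S Act : Type} (M : PreMDP S Act) (f : MemorylessStrategy S Act) :
    MarkovChain S where
  init := M.init
  P s := M.P s (f s)

/-- The mean payoff `liminf_m (1/m) ∑_{j=0}^m γ(s_j)` of a run. -/
def meanPayoff {S : Type} (γ : S → ℝ) (r : ℕ → S) : ℝ :=
  liminf (fun m : ℕ => (1 / (m : ℝ)) * ∑ j ∈ Finset.range (m + 1), γ (r j)) atTop

/-- The value of a memoryless strategy: the expected mean payoff of a run. -/
def MDP.val {S Act : Type} (M : MDP S Act) (f : MemorylessStrategy S Act) : ℝ :=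
  letI : MeasurableSpace S := ⊤
  haveI : DiscreteMeasurableSpace S := ⟨fun _ => trivial⟩
  ∫ r, meanPayoff M.reward r ∂(M.chain f).runMeasure

/-! ### Uniform inputs, and the MDP of a pre-automaton -/

/-- The uniform distribution on `2^I`. -/
def uniformLetter (I : Type) [Fintype I] : PMF (Letter I) :=
  haveI := Classical.decEq I
  PMF.uniformOfFintype (Letter I)

/-- The distribution of the input words: the letters are independent and uniform. -/
def inputMeasure (I : Type) [Fintype I] : Measure (Word (Letter I)) :=
  Measure.infinitePi (fun _ : ℕ => (uniformLetter I).toMeasure)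

/-- The letter `i ∪ o`. -/
abbrev join {I O : Type} (i : Letter I) (o : Letter O) : Letter (I ⊕ O) := Sum.elim i o

section

variable {I O Q : Type} [Fintype I]

/-- The pre-MDP of a pre-automaton over `2^(I ∪ O)`: after the action `o ∈ 2^O`, an input
`i ∈ 2^I` is drawn uniformly and the automaton reads `i ∪ o`. -/
def PreAutomaton.toPreMDP (B : PreAutomaton (Letter (I ⊕ O)) Q) : PreMDP Q (Letter O) where
  init := B.init
  P q o := (uniformLetter I).map (fun i => B.step q (join i o))

/-- The Markov chain of a pre-automaton over `2^I`. -/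
def PreAutomaton.toChain (B : PreAutomaton (Letter I) Q) : MarkovChain Q where
  init := B.init
  P q := (uniformLetter I).map (B.step q)

/-- The run of the MDP of `B` with a memoryless strategy `f` on the input word `w`. -/
def PreAutomaton.runWith (B : PreAutomaton (Letter (I ⊕ O)) Q)
    (f : MemorylessStrategy Q (Letter O)) (w : Word (Letter I)) : ℕ → Q
  | 0 => B.init
  | n + 1 => B.step (B.runWith f w n) (join (w n) (f (B.runWith f w n)))

end

/-! ### The conditional achievability MDP and its reset variant -/

section

variable {I O : Type} [Fintype I]

/-- `U` witnesses that `p` is controllably win recurrent in the parity MDP of `A`. -/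
def DPW.IsCWRWitness {Q : Type} (A : DPW (Letter (I ⊕ O)) Q) (p : Q) (U : Set Q) : Prop :=
  A.toPreMDP.IsEndComponent U ∧ IsMaxRankIn A.rank U p ∧ Even (A.rank p)

variable {Qψ : Type} {W : Set unitInterval} {Q : W → Type}

/-- The product of `Aψ`, which ignores the output signals, with the automata `A v`. -/
def product (Aψ : DPW (Letter I) Qψ) (A : ∀ v : W, DPW (Letter (I ⊕ O)) (Q v)) :
    PreAutomaton (Letter (I ⊕ O)) (Qψ × ∀ v, Q v) where
  init := (Aψ.init, fun v => (A v).init)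
  step s l := (Aψ.step s.1 (l ∘ Sum.inl), fun v => (A v).step (s.2 v) l)

/-- The value `v` is achievable from the state `s` of the product. -/
def Achievable (A : ∀ v : W, DPW (Letter (I ⊕ O)) (Q v)) (s : Qψ × ∀ v, Q v) (v : W) : Prop :=
  ∃ (p : Q v) (U : Set (Q v)), (A v).IsCWRWitness p U ∧ s.2 v ∈ U

open Classical in
/-- The reward: the largest achievable value in states that belong to an end component, and `0` in
all other states. -/
def achievabilityReward (Aψ : DPW (Letter I) Qψ) (A : ∀ v : W, DPW (Letter (I ⊕ O)) (Q v))
    (s : Qψ × ∀ v, Q v) : ℝ :=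
  if ∃ U, (product Aψ A).toPreMDP.IsEndComponent U ∧ s ∈ U then
    sSup {x : ℝ | ∃ v : W, Achievable A s v ∧ x = ((v : unitInterval) : ℝ)}
  else 0

/-- The conditional achievability MDP. -/
def achievabilityMDP (Aψ : DPW (Letter I) Qψ) (A : ∀ v : W, DPW (Letter (I ⊕ O)) (Q v)) :
    MDP (Qψ × ∀ v, Q v) (Letter O) where
  toPreMDP := (product Aψ A).toPreMDP
  reward := achievabilityReward Aψ A

/-- The states in rejecting ergodic components: those in which the maximal rank is odd. -/
def DPW.rejectingErgodic (Aψ : DPW (Letter I) Qψ) : Set Qψ :=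
  {q | ∃ C, Aψ.toChain.IsErgodicComponent C ∧ q ∈ C ∧
    ∃ p, IsMaxRankIn Aψ.rank C p ∧ Odd (Aψ.rank p)}

open Classical in
/-- The reset MDP: rejecting ergodic states go back to the initial state with probability `1`. -/
def resetMDP (Aψ : DPW (Letter I) Qψ) (A : ∀ v : W, DPW (Letter (I ⊕ O)) (Q v)) :
    MDP (Qψ × ∀ v, Q v) (Letter O) where
  init := (achievabilityMDP Aψ A).init
  P s o := if s.1 ∈ Aψ.rejectingErgodic then PMF.pure (achievabilityMDP Aψ A).init
    else (achievabilityMDP Aψ A).P s o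
  reward := (achievabilityMDP Aψ A).reward

/-- The conditional expectation, given `w ⊨ ψ`, of the mean payoff of the run of the conditional
achievability MDP with the strategy `f` on a random input word `w`. -/
def condExpReward (ψ : LTL I) (Aψ : DPW (Letter I) Qψ)
    (A : ∀ v : W, DPW (Letter (I ⊕ O)) (Q v))
    (f : MemorylessStrategy (Qψ × ∀ v, Q v) (Letter O)) : ℝ :=
  ∫ w, meanPayoff (achievabilityMDP Aψ A).reward ((product Aψ A).runWith f w)
    ∂(cond (inputMeasure I) (LTL.models ψ))

end

/-! ### Strategies as strings, and polynomial time -/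

/-- The string that describes a memoryless strategy, with respect to enumerations of the states and
of the output signals: for every state, the truth values of the output signals in the chosen action,
followed by the separator `none`. -/
def encodeStrategy {S O : Type} {n m : ℕ} (eS : S ≃ Fin n) (eO : O ≃ Fin m)
    (f : MemorylessStrategy S (Letter O)) : List (Option Bool) :=
  (List.ofFn fun k : Fin n =>
    (List.ofFn fun j : Fin m => some (f (eS.symm k) (eO.symm j))) ++ [none]).flatten

/-- Computability in polynomial time by a Turing machine (with several stacks). -/
def PolyTime (T : List (Option Bool) → List (Option Bool)) : Prop :=
  Nonempty (Turing.TM2ComputableInPolyTime id id T)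

end HQS

end

open HQS

/-! The strategy `g` itself serves as `f`, so the translation is the identity map; in fact both
values are equal (`val_resetMDP_eq_condExpReward`).

Let V be the value of `g` with resets. Almost every input word eventually drives the automaton for
`ψ` into an ergodic component. There all states recur almost surely (`ae_infOften_eq`), so the
parity of the maximal rank decides acceptance. In an accepting component the run is never reset
again; in a rejecting one it restarts from the initial state and earns V on average, since the mean
payoff ignores finite prefixes. Hence V = E[R; accept] + V · Pr(reject), that is, V · Pr(accept) =
E[R; accept], and division by Pr(accept) > 0 gives the conditional expectation.

To avoid stopping times, `integral_meanPayoff_reset` compares two functions of the starting state: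
the expected payoff with resets, and the expectation of "payoff if accepted, V otherwise". Their
difference vanishes over ergodic components and satisfies a one-step averaging equation elsewhere,
so it is zero by the maximum principle (`eq_zero_of_harmonic`). `runMeasure_eq_map` transfers this
from random words to the law of the Markov chain. -/

noncomputable section

namespace HQS

/-! ### Runs driven by a word -/

/-- The word `a w`. -/
def consWord {Sig : Type} (a : Sig) (w : Word Sig) : Word Sig := fun n => Nat.casesOn n a w

/-- The run from `s` with the transition function `σ` on the word `w`. -/
def runFrom {Sig S : Type} (σ : S → Sig → S) (s : S) (w : Word Sig) : ℕ → S :=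
  PreAutomaton.run ⟨s, σ⟩ w

section Runs

variable {Sig S : Type} (σ : S → Sig → S)

@[simp]
lemma runFrom_zero (s : S) (w : Word Sig) : runFrom σ s w 0 = s := rfl

lemma runFrom_succ (s : S) (w : Word Sig) (n : ℕ) :
    runFrom σ s w (n + 1) = σ (runFrom σ s w n) (w n) := rfl

lemma runFrom_cons_succ (s : S) (a : Sig) (w : Word Sig) (n : ℕ) :
    runFrom σ s (consWord a w) (n + 1) = runFrom σ (σ s a) w n := by
  induction n with
  | zero => rfl
  | succ n ih => rw [runFrom_succ, ih, runFrom_succ]; rfl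

/-- Transition functions that agree on a set that is closed under the first one have the same
runs from this set. -/
lemma runFrom_congr {σ' : S → Sig → S} {D : Set S} (hD : ∀ s ∈ D, ∀ a, σ s a ∈ D)
    (h : ∀ s ∈ D, ∀ a, σ' s a = σ s a) {s : S} (hs : s ∈ D) (w : Word Sig) :
    runFrom σ' s w = runFrom σ s w := by
  have key : ∀ n, runFrom σ s w n ∈ D ∧ runFrom σ' s w n = runFrom σ s w n := by
    intro n
    induction n with
    | zero => exact ⟨hs, rfl⟩
    | succ n ih => exact ⟨hD _ ih.1 _, by rw [runFrom_succ, ih.2, h _ ih.1, runFrom_succ]⟩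
  exact funext fun n => (key n).2

lemma runFrom_mem {D : Set S} (hD : ∀ s ∈ D, ∀ a, σ s a ∈ D) {s : S} (hs : s ∈ D)
    (w : Word Sig) (n : ℕ) : runFrom σ s w n ∈ D := by
  induction n with
  | zero => exact hs
  | succ n ih => exact hD _ ih _

end Runs

/-! ### Harmonic functions on finite graphs -/

section Harmonic

variable {Sig S : Type} [Fintype Sig] [Finite S] {σ : S → Sig → S} {p : Sig → ℝ}

/-- The maximum principle: a function that is harmonic outside of a set `Z` that can be reached
from everywhere, and nonpositive on `Z`, is nonpositive. -/
lemma nonpos_of_harmonic (hp : ∀ a, 0 < p a) (hsum : ∑ a, p a = 1) (D : S → ℝ) (Z : Set S)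
    (hZ : ∀ s ∈ Z, D s ≤ 0) (hD : ∀ s ∉ Z, D s = ∑ a, p a * D (σ s a))
    (hreach : ∀ s, ∃ t ∈ Z, Relation.ReflTransGen (fun x y => ∃ a, σ x a = y) s t) (s : S) :
    D s ≤ 0 := by
  by_contra! hs
  have : Nonempty S := ⟨s⟩
  obtain ⟨m, hm⟩ := Finite.exists_max D
  obtain ⟨t, htZ, hmt⟩ := hreach m
  -- A positive maximum spreads along the path: an average with positive weights equals the maximum
  -- only if every successor attains it. It would thus reach `Z`, where `D` is nonpositive.
  have key : D t = D m := by
    clear htZ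
    induction hmt with
    | refl => rfl
    | @tail x y _ hxy ih =>
      obtain ⟨a, rfl⟩ := hxy
      have hx : x ∉ Z := fun hx => by linarith [hZ x hx, hm s]
      by_contra hne
      have hlt : D (σ x a) < D m := lt_of_le_of_ne (hm _) hne
      have h1 : ∑ b, p b * D (σ x b) < ∑ b, p b * D m :=
        Finset.sum_lt_sum (fun b _ => mul_le_mul_of_nonneg_left (hm _) (hp b).le)
          ⟨a, Finset.mem_univ a, mul_lt_mul_of_pos_left hlt (hp a)⟩
      rw [← hD x hx, ← Finset.sum_mul, hsum, one_mul, ih] at h1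
      exact lt_irrefl _ h1
  linarith [hZ t htZ, hm s]

lemma eq_zero_of_harmonic (hp : ∀ a, 0 < p a) (hsum : ∑ a, p a = 1) (D : S → ℝ) (Z : Set S)
    (hZ : ∀ s ∈ Z, D s = 0) (hD : ∀ s ∉ Z, D s = ∑ a, p a * D (σ s a))
    (hreach : ∀ s, ∃ t ∈ Z, Relation.ReflTransGen (fun x y => ∃ a, σ x a = y) s t) (s : S) :
    D s = 0 := by
  refine le_antisymm
    (nonpos_of_harmonic hp hsum D Z (fun s hs => (hZ s hs).le) hD hreach s) ?_
  have := nonpos_of_harmonic hp hsum (fun s => - D s) Z (fun s hs => by simp [hZ s hs])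
    (fun s hs => by simp [hD s hs]) hreach s
  linarith

/-- In a finite graph, a strongly connected set that cannot be left is reachable from every
vertex. -/
lemma exists_reachable_closed_component (q : S) (edge : S → S → Prop) :
    ∃ (C : Set S) (t : S), t ∈ C ∧ Relation.ReflTransGen edge q t ∧
      StronglyConnectedIn C edge ∧ ∀ x ∈ C, ∀ y, edge x y → y ∈ C := by
  let R : S → Set S := fun x => {y | Relation.ReflTransGen edge x y}
  -- Choose `t` with the fewest reachable vertices: any vertex reachable from `t` then has the same
  -- reachable set, hence leads back to all of it.
  obtain ⟨t, ht, hmin⟩ := Set.exists_min_image (R q) (fun x => (R x).ncard) (Set.toFinite _)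
    ⟨q, Relation.ReflTransGen.refl⟩
  have hclosed : ∀ x ∈ R t, ∀ y, edge x y → y ∈ R t := fun x hx y hxy => hx.tail hxy
  refine ⟨R t, t, Relation.ReflTransGen.refl, ht, ?_, hclosed⟩
  intro x hx y hy
  have hxR : R x = R t := by
    refine Set.eq_of_subset_of_ncard_le (fun z hz => hx.trans hz) (hmin x (ht.trans hx))
      (Set.toFinite _)
  have hxy : y ∈ R x := hxR ▸ hy
  clear hy
  induction hxy with
  | refl => exact Relation.ReflTransGen.refl
  | @tail z u hxz hzu ih =>
    have hz : z ∈ R t := hx.trans hxz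
    exact ih.tail ⟨hz, hclosed z hz u hzu, hzu⟩

end Harmonic

/-! ### Properties of runs that do not depend on a finite prefix -/

section Tail

variable {S : Type}

lemma infOften_shift (r : ℕ → S) : infOften (fun n => r (n + 1)) = infOften r := by
  ext q
  simp only [infOften, Set.mem_ofPred_eq, Filter.frequently_atTop]
  constructor
  · intro h a
    obtain ⟨b, hb, hq⟩ := h a
    exact ⟨b + 1, by omega, hq⟩
  · intro h a
    obtain ⟨b, hb, hq⟩ := h (a + 1)
    exact ⟨b - 1, by omega, by rwa [Nat.sub_add_cancel (by omega)]⟩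

variable {γ : S → ℝ} {B : ℝ}

/-- The factor 2 bounds (m + 1) / m, as m + 1 terms are divided by m. At m = 0 the average is 0
because 1 / 0 = 0. -/
lemma abs_average_le (hγ : ∀ s, |γ s| ≤ B) (r : ℕ → S) (m : ℕ) :
    |(1 / (m : ℝ)) * ∑ j ∈ Finset.range (m + 1), γ (r j)| ≤ 2 * B := by
  have hB : 0 ≤ B := (abs_nonneg _).trans (hγ (r 0))
  rcases Nat.eq_zero_or_pos m with rfl | hm
  · simp [hB]
  have hm' : (1 : ℝ) ≤ m := by exact_mod_cast hm
  have h1 : |∑ j ∈ Finset.range (m + 1), γ (r j)| ≤ (m + 1) * B := by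
    refine (Finset.abs_sum_le_sum_abs _ _).trans ((Finset.sum_le_sum fun j _ => hγ (r j)).trans ?_)
    simp
  rw [abs_mul, abs_of_nonneg (by positivity), div_mul_eq_mul_div, one_mul,
    div_le_iff₀ (by positivity)]
  nlinarith

lemma abs_meanPayoff_le (hγ : ∀ s, |γ s| ≤ B) (r : ℕ → S) : |meanPayoff γ r| ≤ 2 * B := by
  have h := abs_average_le hγ r
  have hb : IsBoundedUnder (· ≥ ·) atTop
      (fun m : ℕ => (1 / (m : ℝ)) * ∑ j ∈ Finset.range (m + 1), γ (r j)) :=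
    isBoundedUnder_of ⟨-(2 * B), fun m => (abs_le.1 (h m)).1⟩
  have hc : IsCoboundedUnder (· ≥ ·) atTop
      (fun m : ℕ => (1 / (m : ℝ)) * ∑ j ∈ Finset.range (m + 1), γ (r j)) :=
    IsBoundedUnder.isCoboundedUnder_ge (isBoundedUnder_of ⟨2 * B, fun m => (abs_le.1 (h m)).2⟩)
  rw [abs_le]
  refine ⟨le_liminf_of_le hc (Eventually.of_forall fun m => (abs_le.1 (h m)).1), ?_⟩
  exact liminf_le_of_frequently_le (Eventually.of_forall fun m => (abs_le.1 (h m)).2).frequently hb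

/-- Superadditivity of the liminf, applied to u and v - u; the bounds are needed because the liminf
is taken in ℝ. -/
lemma liminf_le_liminf_of_tendsto_sub {u v : ℕ → ℝ} (hu : ∃ K, ∀ m, |u m| ≤ K)
    (hv : ∃ K, ∀ m, |v m| ≤ K) (h : Tendsto (fun m => v m - u m) atTop (nhds 0)) :
    liminf u atTop ≤ liminf v atTop := by
  obtain ⟨K, hK⟩ := hu
  obtain ⟨L, hL⟩ := hv
  have hu1 : IsBoundedUnder (· ≥ ·) atTop u := isBoundedUnder_of ⟨-K, fun m => (abs_le.1 (hK m)).1⟩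
  have hu2 : IsBoundedUnder (· ≤ ·) atTop u := isBoundedUnder_of ⟨K, fun m => (abs_le.1 (hK m)).2⟩
  have key := le_liminf_add (f := atTop) (u := u) (v := fun m => v m - u m) hu1
    hu2 h.isBoundedUnder_ge h.isBoundedUnder_le.isCoboundedUnder_ge
  rw [h.liminf_eq, add_zero] at key
  have : u + (fun m => v m - u m) = v := by ext m; simp
  rwa [this] at key

lemma meanPayoff_shift (hγ : ∀ s, |γ s| ≤ B) (r : ℕ → S) :
    meanPayoff γ (fun n => r (n + 1)) = meanPayoff γ r := by
  have hlim : Tendsto (fun m : ℕ =>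
      (1 / (m : ℝ)) * ∑ j ∈ Finset.range (m + 1), γ (r (j + 1)) -
      (1 / (m : ℝ)) * ∑ j ∈ Finset.range (m + 1), γ (r j)) atTop (nhds 0) := by
    have h0 : Tendsto (fun m : ℕ => (1 / (m : ℝ)) * (2 * B)) atTop (nhds 0) := by
      simpa using tendsto_one_div_atTop_nhds_zero_nat.mul_const (2 * B)
    refine squeeze_zero_norm (fun m => ?_) h0
    -- The difference of the two sums telescopes, so the averages differ by at most 2B / m.
    have hs : ∑ j ∈ Finset.range (m + 1), γ (r (j + 1)) - ∑ j ∈ Finset.range (m + 1), γ (r j)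
        = γ (r (m + 1)) - γ (r 0) := by
      rw [← Finset.sum_sub_distrib, Finset.sum_range_sub (fun j => γ (r j))]
    rw [← mul_sub, hs, norm_mul, Real.norm_of_nonneg (by positivity), Real.norm_eq_abs]
    refine mul_le_mul_of_nonneg_left ((abs_sub _ _).trans ?_) (by positivity)
    linarith [hγ (r (m + 1)), hγ (r 0)]
  have b1 : ∃ K, ∀ m : ℕ, |(1 / (m : ℝ)) * ∑ j ∈ Finset.range (m + 1), γ (r (j + 1))| ≤ K :=
    ⟨2 * B, abs_average_le hγ fun n => r (n + 1)⟩
  have b2 : ∃ K, ∀ m : ℕ, |(1 / (m : ℝ)) * ∑ j ∈ Finset.range (m + 1), γ (r j)| ≤ K :=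
    ⟨2 * B, abs_average_le hγ r⟩
  refine le_antisymm (liminf_le_liminf_of_tendsto_sub b1 b2 ?_)
    (liminf_le_liminf_of_tendsto_sub b2 b1 hlim)
  simpa using hlim.neg

end Tail

/-! ### Measurable sets of runs -/

section Measurability

variable {S : Type} [MeasurableSpace S]

lemma measurable_consWord (a : S) : Measurable (consWord a) := by
  refine measurable_pi_iff.2 fun n => ?_
  cases n with
  | zero => exact measurable_const
  | succ n => exact measurable_pi_apply n

variable [DiscreteMeasurableSpace S]

lemma measurableSet_cylinder_of_le (n : ℕ) (x : ℕ → S) :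
    MeasurableSet {r : ℕ → S | ∀ i ≤ n, r i = x i} := by
  have : {r : ℕ → S | ∀ i ≤ n, r i = x i} = ⋂ i ≤ n, (fun r : ℕ → S => r i) ⁻¹' {x i} := by
    ext r; simp
  rw [this]
  exact MeasurableSet.biInter (Set.to_countable _) fun i _ =>
    measurable_pi_apply i (measurableSet_singleton _)

lemma measurableSet_mem_infOften (q : S) : MeasurableSet {r : ℕ → S | q ∈ infOften r} := by
  have : {r : ℕ → S | q ∈ infOften r} =
      ⋂ a : ℕ, ⋃ b ≥ a, (fun r : ℕ → S => r b) ⁻¹' {q} := by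
    ext r; simp [infOften, Filter.frequently_atTop]
  rw [this]
  exact MeasurableSet.iInter fun a => MeasurableSet.biUnion (Set.to_countable _) fun b _ =>
    measurable_pi_apply b (measurableSet_singleton _)

lemma measurable_meanPayoff (γ : S → ℝ) : Measurable (meanPayoff γ) := by
  refine Measurable.liminf fun m => ?_
  refine Measurable.const_mul (Finset.measurable_sum _ fun j _ => ?_) _
  exact (Measurable.of_discrete (f := γ)).comp (measurable_pi_apply j)

/-- The maximal rank that occurs infinitely often in `r` is even. -/
def ParityAccepts {S : Type} (rank : S → ℕ) (r : ℕ → S) : Prop :=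
  ∃ q, IsMaxRankIn rank (infOften r) q ∧ Even (rank q)

lemma measurableSet_parityAccepts [Finite S] (rank : S → ℕ) :
    MeasurableSet {r : ℕ → S | ParityAccepts rank r} := by
  have : {r : ℕ → S | ParityAccepts rank r} = ⋃ q ∈ {q | Even (rank q)},
      ({r : ℕ → S | q ∈ infOften r} ∩ ⋂ t ∈ {t | rank q < rank t}, {r | t ∈ infOften r}ᶜ) := by
    ext r
    simp only [ParityAccepts, IsMaxRankIn, Set.mem_ofPred_eq, Set.mem_iUnion, Set.mem_inter_iff,
      Set.mem_iInter, Set.mem_compl_iff, exists_prop]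
    refine exists_congr fun q => ⟨fun h => ⟨h.2, h.1.1, fun t ht h' => ?_⟩,
      fun h => ⟨⟨h.2.1, fun t ht => ?_⟩, h.1⟩⟩
    · exact absurd (h.1.2 t h') (not_le.2 ht)
    · by_contra hlt
      exact h.2.2 t (not_le.1 hlt) ht
  rw [this]
  exact MeasurableSet.biUnion (Set.to_countable _) fun q _ =>
    (measurableSet_mem_infOften q).inter (MeasurableSet.biInter (Set.to_countable _)
      fun t _ => (measurableSet_mem_infOften t).compl)

end Measurability

lemma sum_toReal_eq_one {Sig : Type} [Fintype Sig] (p : PMF Sig) : ∑ a, (p a).toReal = 1 := by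
  rw [← ENNReal.toReal_sum fun a _ => p.apply_ne_top a, ← tsum_fintype (L := .unconditional _),
    p.tsum_coe, ENNReal.toReal_one]

/-! ### Random words with independent letters -/

section RandomWords

variable {Sig : Type} [Fintype Sig] [MeasurableSpace Sig] [DiscreteMeasurableSpace Sig]
  (p : PMF Sig)

/-- The distribution of the words with independent letters of distribution `p`. -/
def wordMeasure : Measure (Word Sig) := Measure.infinitePi (fun _ : ℕ => p.toMeasure)

instance : IsProbabilityMeasure (wordMeasure p) :=
  inferInstanceAs (IsProbabilityMeasure (Measure.infinitePi _))

/-- The first letter of a random word has distribution `p`, and the rest is again a random word. -/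
lemma wordMeasure_eq_sum : wordMeasure p = ∑ a, p a • (wordMeasure p).map (consWord a) := by
  classical
  symm
  -- Boxes over finite index sets determine the product measure. Each box splits into a condition on
  -- the first letter, present only if `0 ∈ s`, and a box for the remaining word.
  refine Measure.eq_infinitePi _ fun s t ht => ?_
  have hmeas : MeasurableSet (Set.pi (s : Set ℕ) t) :=
    MeasurableSet.pi s.countable_toSet fun i _ => ht i
  have hpre : ∀ a, (wordMeasure p).map (consWord a) (Set.pi (s : Set ℕ) t) =
      (if 0 ∈ s → a ∈ t 0 then 1 else 0) *
        ∏ j ∈ s.preimage Nat.succ Nat.succ_injective.injOn, p.toMeasure (t (j + 1)) := by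
    intro a
    rw [Measure.map_apply (measurable_consWord a) hmeas, wordMeasure,
      ← Measure.infinitePi_pi (fun _ : ℕ => p.toMeasure)
        (s := s.preimage Nat.succ Nat.succ_injective.injOn) (t := fun j => t (j + 1))
        (fun j _ => ht _)]
    split_ifs with h
    · rw [one_mul]
      congr 1
      ext w
      simp only [Set.mem_preimage, Set.mem_pi, SetLike.mem_coe, Finset.mem_preimage]
      constructor
      · intro hw j hj
        exact hw (j + 1) hj
      · intro hw j hj
        cases j with
        | zero => exact h hj
        | succ j => exact hw j hj
    · rw [zero_mul]
      push Not at h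
      convert measure_empty (μ := Measure.infinitePi fun _ : ℕ => p.toMeasure)
      ext w
      simp only [Set.mem_preimage, Set.mem_pi, SetLike.mem_coe, Set.mem_empty_iff_false,
        iff_false]
      exact fun hw => h.2 (hw 0 h.1)
  have hprod : ∏ i ∈ s, p.toMeasure (t i) = (if 0 ∈ s then p.toMeasure (t 0) else 1) *
      ∏ j ∈ s.preimage Nat.succ Nat.succ_injective.injOn, p.toMeasure (t (j + 1)) := by
    have himg : (s.preimage Nat.succ Nat.succ_injective.injOn).image Nat.succ = s.erase 0 := by
      ext j
      cases j <;> simp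
    have h2 : ∏ j ∈ s.preimage Nat.succ Nat.succ_injective.injOn, p.toMeasure (t (j + 1)) =
        ∏ j ∈ s.erase 0, p.toMeasure (t j) := by
      rw [← himg, Finset.prod_image Nat.succ_injective.injOn]
    rw [h2]
    split_ifs with h
    · rw [Finset.mul_prod_erase s (fun j => p.toMeasure (t j)) h]
    · rw [one_mul, Finset.erase_eq_of_notMem h]
  rw [hprod]
  simp only [Measure.coe_finsetSum, Finset.sum_apply, Measure.smul_apply, smul_eq_mul, hpre,
    ← mul_assoc]
  rw [← Finset.sum_mul]
  congr 1
  split_ifs with h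
  · simp [h, PMF.toMeasure_apply_fintype, Set.indicator_apply]
  · have := p.tsum_coe
    rw [tsum_fintype] at this
    simpa [h] using this

lemma wordMeasure_apply_eq_sum {E : Set (Word Sig)} (hE : MeasurableSet E) :
    wordMeasure p E = ∑ a, p a * wordMeasure p (consWord a ⁻¹' E) := by
  conv_lhs => rw [wordMeasure_eq_sum p]
  simp [Measure.map_apply (measurable_consWord _) hE]

/-- With a payoff that ignores the first letter, this becomes the averaging equation over successor
states that the maximum principle needs. -/
lemma integral_wordMeasure {F : Word Sig → ℝ} (hF : Measurable F) {B : ℝ} (hB : ∀ w, |F w| ≤ B) :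
    ∫ w, F w ∂(wordMeasure p) = ∑ a, (p a).toReal * ∫ w, F (consWord a w) ∂(wordMeasure p) := by
  conv_lhs => rw [wordMeasure_eq_sum p]
  have hint : ∀ a, Integrable F ((wordMeasure p).map (consWord a)) := fun a => by
    have := Measure.isProbabilityMeasure_map (μ := wordMeasure p)
      (measurable_consWord a).aemeasurable
    exact Integrable.of_bound hF.aestronglyMeasurable B (Eventually.of_forall hB)
  rw [integral_finsetSum_measure fun a _ => (hint a).smul_measure (p.apply_ne_top a)]
  refine Finset.sum_congr rfl fun a _ => ?_
  rw [integral_smul_measure, integral_map (measurable_consWord a).aemeasurable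
    hF.aestronglyMeasurable, smul_eq_mul]

variable {S : Type} [Finite S] [MeasurableSpace S] [DiscreteMeasurableSpace S]

lemma measurable_runFrom (σ : S → Sig → S) (s : S) : Measurable (runFrom σ s) := by
  refine measurable_pi_iff.2 fun n => ?_
  induction n with
  | zero => exact measurable_const
  | succ n ih =>
    have : Measurable fun x : S × Sig => σ x.1 x.2 := Measurable.of_discrete
    exact this.comp (ih.prodMk (measurable_pi_apply n))

/-! ### The law of a Markov chain -/

/-- A distribution of runs is determined by the probabilities of the finite prefixes. -/
lemma measure_eq_of_cylinder {m m' : Measure (ℕ → S)} [IsProbabilityMeasure m]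
    [IsProbabilityMeasure m']
    (h : ∀ (n : ℕ) (x : ℕ → S), m {r | ∀ i ≤ n, r i = x i} = m' {r | ∀ i ≤ n, r i = x i}) :
    m = m' := by
  -- Both measures turn out to be projective limits of the marginals of `m'`, and such a limit is
  -- unique.
  have hproj : IsProjectiveMeasureFamily (α := fun _ : ℕ => S) (fun J => m'.map J.restrict) := by
    intro J K hK
    rw [Measure.map_map (by fun_prop) (by fun_prop)]
    rfl
  have h' : IsProjectiveLimit (α := fun _ : ℕ => S) m (fun J => m'.map J.restrict) := by
    refine (isProjectiveLimit_nat_iff hproj m).2 fun n => ?_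
    refine Measure.ext_of_singleton fun y => ?_
    have hset : Preorder.frestrictLe (π := fun _ : ℕ => S) n ⁻¹' {y} =
        {r : ℕ → S | ∀ i ≤ n, r i = y ⟨min i n, by simp⟩} := by
      ext r
      simp only [Set.mem_preimage, Set.mem_singleton_iff, Set.mem_ofPred_eq, funext_iff]
      constructor
      · intro hr i hi
        have := hr ⟨i, by simpa using hi⟩
        simpa [hi] using this
      · rintro hr ⟨i, hi⟩
        have hi' : i ≤ n := by simpa using hi
        have := hr i hi'
        simpa [hi'] using this
    have hm : ∀ ν : Measure (ℕ → S), ν.map (Preorder.frestrictLe (π := fun _ : ℕ => S) n) {y} =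
        ν {r : ℕ → S | ∀ i ≤ n, r i = y ⟨min i n, by simp⟩} := fun ν => by
      rw [Measure.map_apply (by fun_prop) (measurableSet_singleton _), hset]
    exact (hm m).trans ((h n fun i => y ⟨min i n, by simp⟩).trans (hm m').symm)
  have h'' : IsProjectiveLimit (α := fun _ : ℕ => S) m' (fun J => m'.map J.restrict) :=
    fun J => rfl
  exact h'.unique h''

open Classical in
lemma wordMeasure_cylinder (σ : S → Sig → S) (n : ℕ) (s : S) (x : ℕ → S) :
    wordMeasure p {w | ∀ i ≤ n, runFrom σ s w i = x i} =
      (if s = x 0 then 1 else 0) * ∏ i ∈ Finset.range n, p.map (σ (x i)) (x (i + 1)) := by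
  induction n generalizing s x with
  | zero => by_cases h : s = x 0 <;> simp [h]
  | succ n ih =>
    have hmeas : MeasurableSet {w | ∀ i ≤ n + 1, runFrom σ s w i = x i} :=
      measurable_runFrom σ s (measurableSet_cylinder_of_le (n + 1) x)
    rw [wordMeasure_apply_eq_sum p hmeas]
    have hpre : ∀ a, wordMeasure p (consWord a ⁻¹' {w | ∀ i ≤ n + 1, runFrom σ s w i = x i}) =
        (if s = x 0 then 1 else 0) *
          wordMeasure p {w | ∀ i ≤ n, runFrom σ (σ s a) w i = x (i + 1)} := by
      intro a
      split_ifs with h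
      · rw [one_mul]
        congr 1
        ext w
        simp only [Set.mem_preimage, Set.mem_ofPred_eq]
        constructor
        · intro hw i hi
          rw [← runFrom_cons_succ]
          exact hw (i + 1) (by omega)
        · intro hw i hi
          cases i with
          | zero => exact h
          | succ i => rw [runFrom_cons_succ]; exact hw i (by omega)
      · rw [zero_mul]
        convert measure_empty (μ := wordMeasure p)
        ext w
        simp only [Set.mem_preimage, Set.mem_ofPred_eq, Set.mem_empty_iff_false, iff_false]
        exact fun hw => h (hw 0 (by omega))
    -- The induction hypothesis contributes the indicator of `σ s a = x 1`; averaged over the letter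
    -- `a`, it yields the transition probability from `x 0` to `x 1`.
    simp only [hpre, ih _ fun i => x (i + 1)]
    rw [Finset.prod_range_succ' (fun i => p.map (σ (x i)) (x (i + 1)))]
    split_ifs with h
    · subst h
      simp only [one_mul, ← mul_assoc]
      rw [← Finset.sum_mul, mul_comm]
      congr 1
      rw [PMF.map_apply, tsum_fintype]
      refine Finset.sum_congr rfl fun a _ => ?_
      simp [eq_comm]
    · simp

-- The product formula of `wordMeasure_cylinder`, now for the Ionescu-Tulcea measure: the joint law
-- of a prefix and the next state is a composition product with the transition kernel.
open Classical in
lemma runMeasure_cylinder (M : MarkovChain S) (n : ℕ) (x : ℕ → S) :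
    M.runMeasure {r | ∀ i ≤ n, r i = x i} =
      (if M.init = x 0 then 1 else 0) * ∏ i ∈ Finset.range n, M.P (x i) (x (i + 1)) := by
  set κ : (n : ℕ) → Kernel ((i : Finset.Iic n) → S) S := fun n =>
    M.kernel.comap (fun h : (i : Finset.Iic n) → S => h ⟨n, by simp⟩) (measurable_pi_apply _)
  have hpre : ∀ n, {r : ℕ → S | ∀ i ≤ n, r i = x i} =
      Preorder.frestrictLe (π := fun _ : ℕ => S) n ⁻¹'
        {Preorder.frestrictLe (π := fun _ : ℕ => S) n x} := by
    intro n
    ext r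
    simp [funext_iff]
  have hpt : ∀ n, M.runMeasure {r | ∀ i ≤ n, r i = x i} =
      Kernel.partialTraj (X := fun _ => S) κ 0 n (fun _ => M.init)
        {Preorder.frestrictLe (π := fun _ : ℕ => S) n x} := by
    intro n
    rw [← Kernel.traj_map_frestrictLe_apply, Measure.map_apply (by fun_prop)
      (measurableSet_singleton _), ← hpre]
    rfl
  induction n with
  | zero =>
    rw [hpt, Kernel.partialTraj_self, Kernel.id_apply, Measure.dirac_apply]
    by_cases h : M.init = x 0
    · have : (fun _ => M.init) = Preorder.frestrictLe (π := fun _ : ℕ => S) 0 x := by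
        funext ⟨i, hi⟩
        obtain rfl : i = 0 := by simpa using hi
        exact h
      simp [h, ← this]
    · have : (fun _ => M.init) ≠ Preorder.frestrictLe (π := fun _ : ℕ => S) 0 x := fun hh =>
        h (congrFun hh ⟨0, by simp⟩)
      simp [h, this]
  | succ n ih =>
    have hset : {r : ℕ → S | ∀ i ≤ n + 1, r i = x i} =
        (fun r => (Preorder.frestrictLe (π := fun _ : ℕ => S) n r, r (n + 1))) ⁻¹'
          ({Preorder.frestrictLe (π := fun _ : ℕ => S) n x} ×ˢ {x (n + 1)}) := by
      ext r
      have := Set.ext_iff.1 (hpre n) r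
      simp only [Set.mem_ofPred_eq, Set.mem_preimage, Set.mem_singleton_iff] at this
      simp only [Set.mem_ofPred_eq, Set.mem_preimage, Set.mem_prod, Set.mem_singleton_iff, ← this,
        Nat.le_succ_iff, or_imp, forall_and, forall_eq]
    have hmap := Kernel.partialTraj_compProd_eq_map_traj (X := fun _ => S) (κ := κ) (Nat.zero_le n)
      (x₀ := fun _ => M.init)
    have hrun : M.runMeasure = Kernel.traj (X := fun _ => S) κ 0 (fun _ => M.init) := rfl
    rw [hset, hrun, ← Measure.map_apply (by fun_prop)
      ((measurableSet_singleton _).prod (measurableSet_singleton _)), ← hmap,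
      Measure.compProd_apply_prod (measurableSet_singleton _) (measurableSet_singleton _),
      lintegral_singleton, ← hpt, ih, Finset.prod_range_succ]
    have hstep : κ n (Preorder.frestrictLe (π := fun _ : ℕ => S) n x) {x (n + 1)} =
        M.P (x n) (x (n + 1)) :=
      PMF.toMeasure_apply_singleton (M.P (x n)) (x (n + 1)) (measurableSet_singleton _)
    rw [hstep]
    ring

instance (M : MarkovChain S) : IsProbabilityMeasure M.runMeasure :=
  inferInstanceAs (IsProbabilityMeasure (Kernel.traj (X := fun _ => S) _ 0 _))

/-- The run of a transition function on a random word is a Markov chain. -/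
lemma runMeasure_eq_map (M : MarkovChain S) (σ : S → Sig → S) (hM : ∀ s, M.P s = p.map (σ s)) :
    M.runMeasure = (wordMeasure p).map (runFrom σ M.init) := by
  have hmeas := measurable_runFrom σ M.init
  have := Measure.isProbabilityMeasure_map (μ := wordMeasure p) hmeas.aemeasurable
  refine measure_eq_of_cylinder fun n x => ?_
  rw [runMeasure_cylinder, Measure.map_apply hmeas (measurableSet_cylinder_of_le n x)]
  simp only [hM]
  exact (wordMeasure_cylinder p σ n M.init x).symm

end RandomWords

/-! ### Ergodic components -/

section Recurrence

lemma toReal_pos_of_ne_zero {Sig : Type} (p : PMF Sig) (hp : ∀ a, p a ≠ 0)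
    (a : Sig) : 0 < (p a).toReal :=
  ENNReal.toReal_pos (hp a) (p.apply_ne_top a)

variable {Sig : Type} [Fintype Sig] [MeasurableSpace Sig] [DiscreteMeasurableSpace Sig]
  (p : PMF Sig) {Q : Type} [Finite Q] [MeasurableSpace Q] [DiscreteMeasurableSpace Q]
  {τ : Q → Sig → Q} {C : Set Q}

/-- In a strongly connected set that cannot be left, every state is visited almost surely. -/
lemma measure_never_visits (hp : ∀ a, p a ≠ 0) (hclosed : ∀ q ∈ C, ∀ a, τ q a ∈ C)
    (hconn : StronglyConnectedIn C (fun x y => ∃ a, τ x a = y)) {q t : Q} (hq : q ∈ C)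
    (ht : t ∈ C) : wordMeasure p {w | ∀ n, runFrom τ q w n ≠ t} = 0 := by
  classical
  have hmeas : ∀ q, MeasurableSet {w : Word Sig | ∀ n, runFrom τ q w n ≠ t} := fun q => by
    have : {w : Word Sig | ∀ n, runFrom τ q w n ≠ t} =
        runFrom τ q ⁻¹' ⋂ n, (fun r : ℕ → Q => r n) ⁻¹' {t}ᶜ := by ext w; simp
    rw [this]
    exact measurable_runFrom τ q (MeasurableSet.iInter fun n =>
      measurable_pi_apply n (measurableSet_singleton t).compl)
  -- The probability of avoiding `t`, extended by 0 outside `C`, is harmonic off `{t} ∪ Cᶜ` and zero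
  -- on it. Including `Cᶜ` makes this boundary reachable from every state.
  have key := eq_zero_of_harmonic (σ := τ) (toReal_pos_of_ne_zero p hp) (sum_toReal_eq_one p)
    (fun q => if q ∈ C then (wordMeasure p).real {w | ∀ n, runFrom τ q w n ≠ t} else 0)
    ({t} ∪ Cᶜ) ?_ ?_ ?_ q
  · rw [if_pos hq, measureReal_eq_zero_iff] at key
    exact key
  · rintro s (rfl | hs)
    · rw [if_pos ht, measureReal_eq_zero_iff]
      convert measure_empty (μ := wordMeasure p)
      ext w
      simp only [Set.mem_ofPred_eq, Set.mem_empty_iff_false, iff_false, not_forall, not_not]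
      exact ⟨0, rfl⟩
    · exact if_neg hs
  · intro s hs
    simp only [Set.mem_union, Set.mem_singleton_iff, Set.mem_compl_iff, not_or, not_not] at hs
    rw [if_pos hs.2, measureReal_def, wordMeasure_apply_eq_sum p (hmeas s), ENNReal.toReal_sum
      fun a _ => ENNReal.mul_ne_top (p.apply_ne_top a) (measure_ne_top _ _)]
    refine Finset.sum_congr rfl fun a _ => ?_
    rw [if_pos (hclosed s hs.2 a), ENNReal.toReal_mul, measureReal_def]
    congr 3
    ext w
    simp only [Set.mem_preimage, Set.mem_ofPred_eq]
    constructor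
    · intro h n
      rw [← runFrom_cons_succ]
      exact h (n + 1)
    · intro h n
      cases n with
      | zero => exact hs.1
      | succ n => rw [runFrom_cons_succ]; exact h n
  · intro s
    by_cases hs : s ∈ C
    · exact ⟨t, Or.inl rfl, Relation.ReflTransGen.mono (fun x y h => h.2.2) _ _ (hconn s hs t ht)⟩
    · exact ⟨s, Or.inr hs, Relation.ReflTransGen.refl⟩

lemma measure_never_visits_after (hp : ∀ a, p a ≠ 0) (hclosed : ∀ q ∈ C, ∀ a, τ q a ∈ C)
    (hconn : StronglyConnectedIn C (fun x y => ∃ a, τ x a = y)) {q t : Q} (hq : q ∈ C)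
    (ht : t ∈ C) (n : ℕ) : wordMeasure p {w | ∀ k ≥ n, runFrom τ q w k ≠ t} = 0 := by
  induction n generalizing q with
  | zero => simpa using measure_never_visits p hp hclosed hconn hq ht
  | succ n ih =>
    have hmeas : MeasurableSet {w : Word Sig | ∀ k ≥ n + 1, runFrom τ q w k ≠ t} := by
      have : {w : Word Sig | ∀ k ≥ n + 1, runFrom τ q w k ≠ t} =
          runFrom τ q ⁻¹' ⋂ k ≥ n + 1, (fun r : ℕ → Q => r k) ⁻¹' {t}ᶜ := by ext w; simp
      rw [this]
      exact measurable_runFrom τ q (MeasurableSet.biInter (Set.to_countable _) fun k _ =>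
        measurable_pi_apply k (measurableSet_singleton t).compl)
    rw [wordMeasure_apply_eq_sum p hmeas]
    refine Finset.sum_eq_zero fun a _ => ?_
    rw [mul_eq_zero]
    refine Or.inr (measure_mono_null ?_ (ih (hclosed q hq a)))
    intro w hw k hk
    rw [← runFrom_cons_succ]
    exact hw (k + 1) (by omega)

/-- In a strongly connected set that cannot be left, exactly the states of this set are visited
infinitely often, almost surely. -/
lemma ae_infOften_eq (hp : ∀ a, p a ≠ 0) (hclosed : ∀ q ∈ C, ∀ a, τ q a ∈ C)
    (hconn : StronglyConnectedIn C (fun x y => ∃ a, τ x a = y)) {q : Q} (hq : q ∈ C) :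
    ∀ᵐ w ∂(wordMeasure p), infOften (runFrom τ q w) = C := by
  have h : ∀ᵐ w ∂(wordMeasure p), ∀ t : Q, t ∈ C → t ∈ infOften (runFrom τ q w) := by
    rw [ae_all_iff]
    intro t
    by_cases ht : t ∈ C
    · have hall : ∀ᵐ w ∂(wordMeasure p), ∀ n : ℕ, ¬ ∀ k ≥ n, runFrom τ q w k ≠ t := by
        rw [ae_all_iff]
        intro n
        rw [ae_iff]
        simpa only [not_not] using measure_never_visits_after p hp hclosed hconn hq ht n
      filter_upwards [hall] with w hw _
      refine Filter.frequently_atTop.2 fun n => ?_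
      have := hw n
      push Not at this
      exact this
    · exact Eventually.of_forall fun w h => absurd h ht
  filter_upwards [h] with w hw
  refine Set.Subset.antisymm (fun t ht => ?_) fun t ht => hw t ht
  obtain ⟨n, hn⟩ := Filter.Frequently.exists ht
  exact hn ▸ runFrom_mem τ hclosed hq w n

end Recurrence

/-! ### Ergodic components of parity automata on uniform inputs -/

section Ergodic

variable {I : Type} [Fintype I]

lemma uniformLetter_ne_zero (i : Letter I) : uniformLetter I i ≠ 0 := by
  classical
  rw [uniformLetter, PMF.uniformOfFintype_apply]
  simp

variable {Q : Type}

lemma PreAutomaton.toChain_pos_iff (B : PreAutomaton (Letter I) Q) (x y : Q) :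
    0 < B.toChain.P x y ↔ ∃ i, B.step x i = y := by
  rw [PMF.apply_pos_iff]
  change y ∈ ((uniformLetter I).map (B.step x)).support ↔ _
  rw [PMF.mem_support_map_iff]
  exact ⟨fun ⟨i, _, h⟩ => ⟨i, h⟩, fun ⟨i, h⟩ =>
    ⟨i, (PMF.mem_support_iff _ _).2 (uniformLetter_ne_zero i), h⟩⟩

/-- Every letter has positive probability, so the support of the chain is the transition graph. -/
lemma PreAutomaton.isErgodicComponent_iff (B : PreAutomaton (Letter I) Q) (C : Set Q) :
    B.toChain.IsErgodicComponent C ↔ C.Nonempty ∧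
      StronglyConnectedIn C (fun x y => ∃ i, B.step x i = y) ∧ ∀ q ∈ C, ∀ i, B.step q i ∈ C := by
  simp only [MarkovChain.IsErgodicComponent, B.toChain_pos_iff]
  refine and_congr_right fun _ => and_congr_right fun _ => ?_
  constructor
  · intro h q hq i
    by_contra hn
    exact ((B.toChain_pos_iff q _).2 ⟨i, rfl⟩).ne' (h q hq _ hn)
  · intro h s hs t ht
    by_contra hn
    obtain ⟨i, rfl⟩ := (B.toChain_pos_iff s t).1 (pos_iff_ne_zero.2 hn)
    exact ht (h s hs i)

variable (A : DPW (Letter I) Q) {C : Set Q}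

/-- No state of an ergodic component that contains a state that is not rejecting is rejecting. -/
lemma DPW.notMem_rejectingErgodic_of_mem (hC : A.toChain.IsErgodicComponent C) {q q' : Q}
    (hq : q ∈ C) (hq' : q' ∈ C) (h : q ∉ A.rejectingErgodic) : q' ∉ A.rejectingErgodic := by
  rintro ⟨C', hC', hqC', hodd⟩
  refine h ⟨C', hC', ?_, hodd⟩
  have hclosed := ((A.isErgodicComponent_iff C').1 hC').2.2
  -- A path in `C` from `q'` cannot leave `C'`, so `q` also lies in the rejecting component `C'`.
  have hreach : ∀ x, Relation.ReflTransGen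
      (fun x y => x ∈ C ∧ y ∈ C ∧ ∃ i, A.step x i = y) q' x → x ∈ C' := by
    intro x hx
    induction hx with
    | refl => exact hqC'
    | tail _ hxy ih =>
      obtain ⟨_, _, i, rfl⟩ := hxy
      exact hclosed _ ih i
  exact hreach q (((A.isErgodicComponent_iff C).1 hC).2.1 q' hq' q hq)

variable [Finite Q] [MeasurableSpace Q] [DiscreteMeasurableSpace Q]

lemma DPW.ae_not_parityAccepts {q : Q} (hq : q ∈ A.rejectingErgodic) :
    ∀ᵐ w ∂(inputMeasure I), ¬ ParityAccepts A.rank (runFrom A.step q w) := by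
  classical
  obtain ⟨C, hC, hqC, t, ht, hodd⟩ := hq
  obtain ⟨-, hconn, hclosed⟩ := (A.isErgodicComponent_iff C).1 hC
  filter_upwards [ae_infOften_eq (uniformLetter I) uniformLetter_ne_zero hclosed hconn hqC]
    with w hw
  rintro ⟨u, hu, heven⟩
  rw [hw] at hu
  have : A.rank u = A.rank t := le_antisymm (ht.2 u hu.1) (hu.2 t ht.1)
  rw [this] at heven
  exact (Nat.not_even_iff_odd.2 hodd) heven

lemma DPW.ae_parityAccepts (hC : A.toChain.IsErgodicComponent C) {q : Q} (hqC : q ∈ C)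
    (hq : q ∉ A.rejectingErgodic) :
    ∀ᵐ w ∂(inputMeasure I), ParityAccepts A.rank (runFrom A.step q w) := by
  classical
  obtain ⟨hne, hconn, hclosed⟩ := (A.isErgodicComponent_iff C).1 hC
  obtain ⟨t, htC, ht⟩ := Set.exists_max_image C A.rank (Set.toFinite _) hne
  -- An odd maximal rank would make `C` itself a witness that `q` is rejecting.
  have heven : Even (A.rank t) := by
    by_contra hodd
    exact hq ⟨C, hC, hqC, t, ⟨htC, ht⟩, Nat.not_even_iff_odd.1 hodd⟩
  filter_upwards [ae_infOften_eq (uniformLetter I) uniformLetter_ne_zero hclosed hconn hqC]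
    with w hw
  exact ⟨t, by rw [hw]; exact ⟨htC, ht⟩, heven⟩

lemma runFrom_cons_parityAccepts_iff {Sig S : Type} (rank : S → ℕ) (σ : S → Sig → S) (s : S)
    (a : Sig) (w : Word Sig) : ParityAccepts rank (runFrom σ s (consWord a w)) ↔
      ParityAccepts rank (runFrom σ (σ s a) w) := by
  rw [ParityAccepts, ← infOften_shift]
  simp only [runFrom_cons_succ]
  rfl

lemma meanPayoff_runFrom_cons {Sig S : Type} {γ : S → ℝ} {B : ℝ} (hγ : ∀ s, |γ s| ≤ B)
    (σ : S → Sig → S) (s : S) (a : Sig) (w : Word Sig) :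
    meanPayoff γ (runFrom σ s (consWord a w)) = meanPayoff γ (runFrom σ (σ s a) w) := by
  rw [← meanPayoff_shift hγ]
  simp only [runFrom_cons_succ]

end Ergodic

/-! ### Resetting rejected runs -/

section Reset

variable {I : Type} [Fintype I] {Q : Type} [Finite Q] [MeasurableSpace Q]
  [DiscreteMeasurableSpace Q] {S : Type} [Finite S] [MeasurableSpace S] [DiscreteMeasurableSpace S]

open Classical in
/-- Resetting the runs whose projection reaches a rejecting ergodic component of `A` amounts to
conditioning on acceptance by `A`. -/
theorem integral_meanPayoff_reset (A : DPW (Letter I) Q) (σ : S → Letter I → S) (π : S → Q)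
    (hπ : ∀ s i, π (σ s i) = A.step (π s) i) (γ : S → ℝ) (s₀ : S) :
    (∫ w, meanPayoff γ
        (runFrom (fun s i => if π s ∈ A.rejectingErgodic then s₀ else σ s i) s₀ w)
        ∂(inputMeasure I)) *
      (inputMeasure I).real {w | ParityAccepts A.rank (runFrom A.step (π s₀) w)} =
    ∫ w in {w | ParityAccepts A.rank (runFrom A.step (π s₀) w)},
      meanPayoff γ (runFrom σ s₀ w) ∂(inputMeasure I) := by
  set σ' : S → Letter I → S := fun s i => if π s ∈ A.rejectingErgodic then s₀ else σ s i with hσ'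
  obtain ⟨B, hγ⟩ : ∃ B, ∀ s, |γ s| ≤ B := by
    have : Nonempty S := ⟨s₀⟩
    obtain ⟨m, hm⟩ := Finite.exists_max fun s => |γ s|
    exact ⟨_, hm⟩
  set μ := wordMeasure (uniformLetter I)
  have hμ' : inputMeasure I = μ := rfl
  rw [hμ']
  set V := ∫ w, meanPayoff γ (runFrom σ' s₀ w) ∂μ
  let acc : S → Set (Word (Letter I)) := fun s =>
    {w | ParityAccepts A.rank (runFrom A.step (π s) w)}
  have hacc : ∀ s, MeasurableSet (acc s) := fun s =>
    measurable_runFrom A.step (π s) (measurableSet_parityAccepts A.rank)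
  have hF : ∀ (ρ : S → Letter I → S) s, Measurable fun w => meanPayoff γ (runFrom ρ s w) :=
    fun ρ s => (measurable_meanPayoff γ).comp (measurable_runFrom ρ s)
  have hFb : ∀ (ρ : S → Letter I → S) s w, |meanPayoff γ (runFrom ρ s w)| ≤ 2 * B :=
    fun ρ s w => abs_meanPayoff_le hγ _
  have hFi : ∀ (ρ : S → Letter I → S) s, Integrable (fun w => meanPayoff γ (runFrom ρ s w)) μ :=
    fun ρ s => Integrable.of_bound (hF ρ s).aestronglyMeasurable (2 * B)
      (Eventually.of_forall (hFb ρ s))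
  -- A rejected run is credited with `V`, the expected payoff of the restart that awaits it.
  let H : S → Word (Letter I) → ℝ := fun s =>
    (acc s).piecewise (fun w => meanPayoff γ (runFrom σ s w)) fun _ => V
  have hH : ∀ s, Measurable (H s) := fun s => (hF σ s).piecewise (hacc s) measurable_const
  have hHb : ∀ s w, |H s w| ≤ 2 * B + |V| := fun s w => by
    by_cases hw : w ∈ acc s
    · simp only [H, Set.piecewise_eq_of_mem _ _ _ hw]
      linarith [hFb σ s w, abs_nonneg V]
    · simp only [H, Set.piecewise_eq_of_notMem _ _ _ hw]
      linarith [(abs_nonneg _).trans (hFb σ s w)]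
  have hHcons : ∀ s i w, H s (consWord i w) = H (σ s i) w := fun s i w => by
    have hiff : consWord i w ∈ acc s ↔ w ∈ acc (σ s i) := by
      simp only [acc, Set.mem_ofPred_eq, hπ]
      exact runFrom_cons_parityAccepts_iff _ _ _ _ _
    by_cases hw : w ∈ acc (σ s i)
    · simp only [H, Set.piecewise_eq_of_mem _ _ _ hw, Set.piecewise_eq_of_mem _ _ _ (hiff.2 hw)]
      exact meanPayoff_runFrom_cons hγ _ _ _ _
    · simp only [H, Set.piecewise_eq_of_notMem _ _ _ hw,
        Set.piecewise_eq_of_notMem _ _ _ (fun h => hw (hiff.1 h))]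
  have key : ∀ s, ∫ w, meanPayoff γ (runFrom σ' s w) ∂μ - ∫ w, H s w ∂μ = 0 := by
    refine eq_zero_of_harmonic (σ := σ)
      (toReal_pos_of_ne_zero (uniformLetter I) uniformLetter_ne_zero)
      (sum_toReal_eq_one (uniformLetter I)) _
      {s | ∃ C, A.toChain.IsErgodicComponent C ∧ π s ∈ C} ?_ ?_ ?_
    · rintro s ⟨C, hC, hs⟩
      rw [sub_eq_zero]
      by_cases hrej : π s ∈ A.rejectingErgodic
      -- The first step leads to `s₀` whatever the letter, and dropping it does not change the mean
      -- payoff.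
      · have h1 : ∫ w, meanPayoff γ (runFrom σ' s w) ∂μ = V := by
          rw [integral_wordMeasure _ (hF σ' s) (hFb σ' s)]
          simp only [meanPayoff_runFrom_cons hγ]
          simp only [hσ', if_pos hrej]
          rw [← Finset.sum_mul, sum_toReal_eq_one, one_mul]
        have h2 : ∫ w, H s w ∂μ = ∫ _, V ∂μ := by
          refine integral_congr_ae ?_
          filter_upwards [A.ae_not_parityAccepts hrej] with w hw
          exact Set.piecewise_eq_of_notMem _ _ _ hw
        rw [h1, h2]
        simp
      · refine integral_congr_ae ?_
        filter_upwards [A.ae_parityAccepts hC hs hrej] with w hw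
        have hw' : w ∈ acc s := hw
        simp only [H, Set.piecewise_eq_of_mem _ _ _ hw']
        -- The states over `C` are closed under `σ` and none of them is reset, so both runs
        -- coincide.
        rw [runFrom_congr σ (σ' := σ') (D := π ⁻¹' C) ?_ ?_ hs w]
        · intro t ht i
          change π (σ t i) ∈ C
          rw [hπ]
          exact ((A.isErgodicComponent_iff C).1 hC).2.2 _ ht i
        · intro t ht i
          exact if_neg (A.notMem_rejectingErgodic_of_mem hC hs ht hrej)
    -- Rejecting states lie in ergodic components, so no reset happens here and both expectations
    -- average over the same successors.
    · intro s hs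
      have hrej : π s ∉ A.rejectingErgodic := fun ⟨C, hC, hsC, _⟩ => hs ⟨C, hC, hsC⟩
      rw [integral_wordMeasure _ (hF σ' s) (hFb σ' s), integral_wordMeasure _ (hH s) (hHb s),
        ← Finset.sum_sub_distrib]
      refine Finset.sum_congr rfl fun i _ => ?_
      rw [← mul_sub]
      simp only [hHcons, meanPayoff_runFrom_cons hγ]
      have : σ' s i = σ s i := if_neg hrej
      rw [this]
    · intro s
      obtain ⟨C, t, htC, hst, hconn, hclosed⟩ :=
        exists_reachable_closed_component (π s) (fun x y => ∃ i, A.step x i = y)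
      have hC : A.toChain.IsErgodicComponent C := (A.isErgodicComponent_iff C).2
        ⟨⟨t, htC⟩, hconn, fun q hq i => hclosed q hq _ ⟨i, rfl⟩⟩
      -- Since `π` commutes with reading a letter, a path of `A` into an ergodic component lifts to
      -- a path in `S`.
      suffices h : ∃ u, π u = t ∧ Relation.ReflTransGen (fun x y => ∃ i, σ x i = y) s u by
        obtain ⟨u, rfl, hu⟩ := h
        exact ⟨u, ⟨C, hC, htC⟩, hu⟩
      clear htC hC
      induction hst with
      | refl => exact ⟨s, rfl, Relation.ReflTransGen.refl⟩
      | tail _ hxy ih =>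
        obtain ⟨u, rfl, hu⟩ := ih
        obtain ⟨i, rfl⟩ := hxy
        exact ⟨σ u i, hπ u i, hu.tail ⟨i, rfl⟩⟩
  -- At `s₀` the first expectation is `V` itself, so the identity becomes an equation for `V`.
  have hfin := key s₀
  have hsplit : ∫ w, H s₀ w ∂μ =
      ∫ w in acc s₀, meanPayoff γ (runFrom σ s₀ w) ∂μ + ∫ _ in (acc s₀)ᶜ, V ∂μ :=
    integral_piecewise (hacc s₀) (hFi σ s₀).integrableOn (integrable_const V).integrableOn
  rw [hsplit, setIntegral_const, probReal_compl_eq_one_sub (hacc s₀), smul_eq_mul] at hfin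
  change V * μ.real (acc s₀) = ∫ w in acc s₀, meanPayoff γ (runFrom σ s₀ w) ∂μ
  linarith

end Reset

/-! ### The value of a strategy in the reset process -/

section Value

variable {I O : Type}

lemma PreAutomaton.runWith_eq_runFrom {Q : Type} (B : PreAutomaton (Letter (I ⊕ O)) Q)
    (f : MemorylessStrategy Q (Letter O)) (w : Word (Letter I)) :
    B.runWith f w = runFrom (fun q i => B.step q (join i (f q))) B.init w := by
  funext n
  induction n with
  | zero => rfl
  | succ n ih => rw [runFrom_succ, ← ih]; rfl

variable [Fintype I] {Qψ : Type} [Finite Qψ] {W : Set unitInterval} [Finite W] {Q : W → Type}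
  [∀ v, Finite (Q v)]

/-- A memoryless strategy has the same value in the reset process as in the original process
conditioned on acceptance. -/
theorem val_resetMDP_eq_condExpReward (ψ : LTL I) (Aψ : DPW (Letter I) Qψ)
    (A : ∀ v : W, DPW (Letter (I ⊕ O)) (Q v)) (hlang : Aψ.language = LTL.models ψ)
    (hpos : 0 < inputMeasure I (LTL.models ψ))
    (g : MemorylessStrategy (Qψ × ∀ v, Q v) (Letter O)) :
    (resetMDP Aψ A).val g = condExpReward ψ Aψ A g := by
  classical
  let S := Qψ × ∀ v, Q v
  let : MeasurableSpace S := ⊤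
  have : DiscreteMeasurableSpace S := ⟨fun _ => trivial⟩
  let : MeasurableSpace Qψ := ⊤
  have : DiscreteMeasurableSpace Qψ := ⟨fun _ => trivial⟩
  let σ : S → Letter I → S := fun s i => (product Aψ A).step s (join i (g s))
  let σ' : S → Letter I → S := fun s i =>
    if s.1 ∈ Aψ.rejectingErgodic then (product Aψ A).init else σ s i
  have hP : ∀ s, ((resetMDP Aψ A).chain g).P s = (uniformLetter I).map (σ' s) := by
    intro s
    change (if s.1 ∈ Aψ.rejectingErgodic then PMF.pure (product Aψ A).init
      else (uniformLetter I).map (σ s)) = _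
    by_cases hs : s.1 ∈ Aψ.rejectingErgodic
    -- A reset is also driven by letters: a constant map pushes the uniform distribution to a point
    -- mass.
    · have : σ' s = Function.const _ (product Aψ A).init := funext fun i => if_pos hs
      rw [if_pos hs, this, PMF.map_const]
    · have : σ' s = σ s := funext fun i => if_neg hs
      rw [if_neg hs, this]
  have hval : (resetMDP Aψ A).val g = ∫ w, meanPayoff (achievabilityMDP Aψ A).reward
      (runFrom σ' (product Aψ A).init w) ∂(inputMeasure I) := by
    have hlaw := runMeasure_eq_map (uniformLetter I) ((resetMDP Aψ A).chain g) σ' hP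
    change ∫ r, meanPayoff (achievabilityMDP Aψ A).reward r
      ∂((resetMDP Aψ A).chain g).runMeasure = _
    rw [hlaw, integral_map (measurable_runFrom σ' _).aemeasurable
      (measurable_meanPayoff _).aestronglyMeasurable]
    rfl
  have hmodels : {w | ParityAccepts Aψ.rank (runFrom Aψ.step (product Aψ A).init.1 w)} =
      LTL.models ψ := hlang
  have hmain := integral_meanPayoff_reset Aψ σ (fun s : S => s.1) (fun s i => rfl)
    (achievabilityMDP Aψ A).reward (product Aψ A).init
  rw [hmodels] at hmain
  have hμ : IsProbabilityMeasure (inputMeasure I) :=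
    inferInstanceAs (IsProbabilityMeasure (wordMeasure (uniformLetter I)))
  have hne : (inputMeasure I).real (LTL.models ψ) ≠ 0 :=
    (ENNReal.toReal_pos hpos.ne' (measure_ne_top _ _)).ne'
  rw [hval, eq_div_of_mul_eq hne hmain, condExpReward]
  simp only [PreAutomaton.runWith_eq_runFrom]
  -- The conditional measure is the restriction scaled by the inverse probability, which matches the
  -- quotient just obtained.
  rw [ProbabilityTheory.cond, integral_smul_measure, ENNReal.toReal_inv, smul_eq_mul,
    div_eq_inv_mul]
  rfl

end Value

end HQS

end

theorem mainTheorem7 :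
    ∃ T : List (Option Bool) → List (Option Bool), PolyTime T ∧
      ∀ (I O : Type) [Fintype I] [Fintype O]
        (F : QualityOps) (φ : FLTL F (I ⊕ O)) (ψ : LTL I)
        (Qψ : Type) [Finite Qψ] (Aψ : DPW (Letter I) Qψ)
        (Q : φ.values → Type) [∀ v, Finite (Q v)] (A : ∀ v, DPW (Letter (I ⊕ O)) (Q v)),
        Aψ.language = LTL.models ψ →
        (∀ v : φ.values, (A v).language = {π | φ.sem π = v}) →
        0 < inputMeasure I (LTL.models ψ) →
        ∀ (n m : ℕ) (eS : (Qψ × ∀ v, Q v) ≃ Fin n) (eO : O ≃ Fin m)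
          (v : ℝ) (g : MemorylessStrategy (Qψ × ∀ v, Q v) (Letter O)),
          v ≤ (resetMDP Aψ A).val g →
          ∃ f : MemorylessStrategy (Qψ × ∀ v, Q v) (Letter O),
            T (encodeStrategy eS eO g) = encodeStrategy eS eO f ∧
            v ≤ condExpReward ψ Aψ A f := by
  refine ⟨id, ⟨Turing.idComputableInPolyTime id⟩, ?_⟩
  intro I O _ _ F φ ψ Qψ _ Aψ Q _ A hlang _ hpos n m eS eO v g hv
  exact ⟨g, rfl, hv.trans_eq (val_resetMDP_eq_condExpReward ψ Aψ A hlang hpos g)⟩
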